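/- For a regular infinite cardinal $\kappa$ let $J^{\rm bd}_\kappa$ be the ideal of bounded subsets of $\kappa$. For an ideal $J$ on $\kappa$ and a cardinal $\chi\ge\kappa$, let $\mathbf U_J(\chi)$ be the least cardinality of a family $\mathcal A$ of subsets of $\chi$, each of cardinality $\kappa$, such that for every function $f:\kappa\to\chi$ there is $A\in\mathcal A$ with $\{i<\kappa: f(i)\in A\}\notin J$. A sequence $\langle \mathcal I_\alpha:\alpha<\alpha^*\rangle$ of linear orders is $\kappa$-entangled if each $\mathcal I_\alpha$ has cardinality at least $\kappa$ and, whenever $n<\omega$, $\alpha_1<\dots<\alpha_n<\alpha^*$, and for each $\ell\in\{1,\dots,n\}$ $\langle t^\ell_\zeta:\zeta<\kappa\rangle$ is a sequence of pairwise distinct elements of $\mathcal I_{\alpha_\ell}$, then for every $w\subseteq\{1,\dots,n\}$ there are $\zeta<\xi<\kappa$ such that $t^\ell_\zeta<t^\ell_\xi$ for all $\ell\in w$ and $t^\ell_\xi<t^\ell_\zeta$ for all $\ell\in\{1,\dots,n\}\setminus w$. The sequence is entangled if it is $\kappa$-entangled for $\kappa=\min\{|\mathcal I_\alpha|:\alpha<\alpha^*\}$.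 (1) Let $\kappa$ be an uncountable regular cardinal and $\kappa<\chi\le 2^{\aleph_0}$. If $\mathbf U_{J^{\rm bd}_\kappa}(\chi)>2^{\aleph_0}$, then there is an entangled sequence of length $\mathbf U_{J^{\rm bd}_\kappa}(\chi)$ of linear orders, each of cardinality $\kappa$. Moreover, the condition $\mathbf U_{J^{\rm bd}_\kappa}(\chi)>2^{\aleph_0}$ holds whenever $\chi=2^{\aleph_0}$ and ${\rm cf}(\chi)=\kappa<\chi$. (2) Let $\mu$ be a strong limit singular cardinal, $\kappa$ a regular cardinal, and $\mu<\kappa<\chi\le 2^\mu$. If $\mathbf U_{J^{\rm bd}_\kappa}(\chi)>2^\mu$, then there is an entangled sequence of length $\mathbf U_{J^{\rm bd}_\kappa}(\chi)$ of linear orders, each of cardinality $\kappa$. Moreover, the condition $\mathbf U_{J^{\rm bd}_\kappa}(\chi)>2^\mu$ holds whenever $\chi=2^\mu$ and ${\rm cf}(\chi)=\kappa<\chi$. -/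

import Mathlib

open Cardinal

universe u

namespace Entangled

/-- The ideal `J^bd` of bounded subsets of a linear order `α` (used for an infinite regular
cardinal, seen as a well-order). The clause `s = ∅` only matters when `α` is empty. -/
def bddIdeal (α : Type u) [LinearOrder α] : Order.Ideal (Set α) where
  carrier := {s | s = ∅ ∨ BddAbove s}
  lower' := by
    rintro s t hts (rfl | hs)
    · exact Or.inl (Set.subset_empty_iff.1 hts)
    · exact Or.inr (hs.mono hts)
  nonempty' := ⟨∅, Or.inl rfl⟩
  directed' := by
    rintro s hs t ht
    refine ⟨s ∪ t, ?_, Set.subset_union_left, Set.subset_union_right⟩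
    rcases hs with rfl | hs
    · simpa using ht
    · rcases ht with rfl | ht
      · exact Or.inr (by simpa using hs)
      · rcases isEmpty_or_nonempty α with h | h
        · exact Or.inl (Set.eq_empty_of_isEmpty _)
        · exact Or.inr (hs.union ht)

/-- The cardinal `U_J(χ)` of an ideal `J` on `κ`: the least cardinality of a family `A` of
subsets of `χ`, each of cardinality `κ`, such that for every function `f : κ → χ` there is
a member `a` of `A` for which `{i < κ : f i ∈ a}` is `J`-positive. Here a cardinal is identified
with the well-order of its initial ordinal. -/
noncomputable def U {κ : Cardinal.{u}} (J : Order.Ideal (Set κ.ord.ToType))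
    (χ : Cardinal.{u}) : Cardinal.{u} :=
  sInf {c | ∃ A : Set (Set χ.ord.ToType), #A = c ∧ (∀ a ∈ A, #a = κ) ∧
    ∀ f : κ.ord.ToType → χ.ord.ToType, ∃ a ∈ A, {i | f i ∈ a} ∉ J}

/-- The sequence `I` of linear orders, indexed by `ι`, is `κ`-entangled. -/
def IsEntangledFor (κ : Cardinal.{u}) {ι : Type u} [LinearOrder ι] (I : ι → Type u)
    [∀ a, LinearOrder (I a)] : Prop :=
  (∀ a, κ ≤ #(I a)) ∧
  ∀ (n : ℕ) (a : Fin n → ι), StrictMono a →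
    ∀ t : ∀ l : Fin n, κ.ord.ToType → I (a l), (∀ l, Function.Injective (t l)) →
      ∀ w : Set (Fin n), ∃ ζ ξ : κ.ord.ToType, ζ < ξ ∧
        (∀ l ∈ w, t l ζ < t l ξ) ∧ (∀ l ∉ w, t l ξ < t l ζ)

/-- The sequence `I` of linear orders is entangled: it is `κ`-entangled for the minimum `κ` of
the cardinalities of its members. -/
def IsEntangled {ι : Type u} [LinearOrder ι] (I : ι → Type u)
    [∀ a, LinearOrder (I a)] : Prop :=
  IsEntangledFor (⨅ a, #(I a)) I

/-- `Ens(κ, lam)`: there is an entangled sequence of length `lam` of linear orders, each of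
cardinality `κ`. -/
def Ens (κ lam : Cardinal.{u}) : Prop :=
  ∃ (I : lam.ord.ToType → Type u) (_ : ∀ a, LinearOrder (I a)),
    (∀ a, #(I a) = κ) ∧ IsEntangled I

end Entangled

namespace Entangled

/-! Fix a linear order `L` of size `2 ^ μ` whose points are separated by at most `μ` cuts (for
countable `κ`-bounds, `μ = ℵ₀`; both parts are one argument). Once a subset `E` of `Q ^ n × Q` is
fixed, a tuple from `L` computes at most one further point, so there are only `2 ^ μ` ways of
computing a point from finitely many others. As `U > 2 ^ μ`, recursion of length `U` gives `f α : κ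
→ L` almost avoiding every point computable from values of earlier `f β` (`exists_avoiding`). The
ranges of the `f α` are entangled: if a pattern failed, the failure itself would be a code computing
almost all terms of the last sequence from the others (`exists_cut`). The cofinality clause is a
diagonalization of length `κ = cf χ` (`lt_U_of_cof_eq`). -/

theorem mk_Iio_ord_toType_lt {c : Cardinal.{u}} (k : c.ord.ToType) : #(Set.Iio k) < c := by
  simpa using mk_Iio_lt k (by simp)

theorem mk_Iic_ord_toType_lt {c : Cardinal.{u}} (hc : ℵ₀ ≤ c) (k : c.ord.ToType) :
    #(Set.Iic k) < c := by
  have : Set.Iic k = insert k (Set.Iio k) := by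
    ext x
    simp [le_iff_eq_or_lt]
  rw [this]
  refine (mk_insert_le).trans_lt (add_lt_of_lt hc (mk_Iio_ord_toType_lt k) ?_)
  exact one_lt_aleph0.trans_le hc

theorem mk_lt_of_mem_bddIdeal {κ : Cardinal.{u}} (hκ : ℵ₀ ≤ κ) {s : Set κ.ord.ToType}
    (hs : s ∈ bddIdeal κ.ord.ToType) : #s < κ := by
  rcases hs with rfl | ⟨k, hk⟩
  · simpa using aleph0_pos.trans_le hκ
  · exact (mk_le_mk_of_subset fun i hi => hk hi).trans_lt (mk_Iic_ord_toType_lt hκ k)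

theorem exists_superset_mk_eq {α : Type u} {c : Cardinal.{u}} (hc : ℵ₀ ≤ c) (hα : c ≤ #α)
    {s : Set α} (hs : #s ≤ c) : ∃ t, s ⊆ t ∧ #t = c := by
  obtain ⟨t, ht⟩ := le_mk_iff_exists_set.1 hα
  refine ⟨s ∪ t, Set.subset_union_left, le_antisymm ?_ ?_⟩
  · exact (mk_union_le s t).trans (add_le_of_le hc hs ht.le)
  · exact ht ▸ mk_le_mk_of_subset Set.subset_union_right

/-- A family of fewer than `U_{J^bd}(χ)` sets of size at most `κ` is avoided, up to small sets, by
some function on `κ` with values in a given copy of `χ`. -/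
theorem exists_avoiding {κ χ : Cardinal.{u}} (hκ : ℵ₀ ≤ κ) (hκχ : κ ≤ χ) {L T : Type u}
    (j : χ.ord.ToType ↪ L) (s : T → Set L) (hs : ∀ t, #(s t) ≤ κ)
    (hT : #T < U (bddIdeal κ.ord.ToType) χ) :
    ∃ f : κ.ord.ToType → L, ∀ t, #{i | f i ∈ s t} < κ := by
  have hs' : ∀ t, ∃ a : Set χ.ord.ToType, j ⁻¹' s t ⊆ a ∧ #a = κ := fun t =>
    exists_superset_mk_eq hκ (by simpa using hκχ)
      ((mk_preimage_of_injective _ _ j.injective).trans (hs t))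
  choose a hsa ha using hs'
  by_contra! H
  refine absurd ((csInf_le' (a := #(Set.range a)) ?_).trans mk_range_le) hT.not_ge
  refine ⟨Set.range a, rfl, by rintro _ ⟨t, rfl⟩; exact ha t, fun g => ?_⟩
  obtain ⟨t, ht⟩ := H (j ∘ g)
  refine ⟨a t, ⟨t, rfl⟩, fun hJ => absurd (mk_lt_of_mem_bddIdeal hκ hJ) (not_lt.2 ?_)⟩
  exact ht.trans (mk_le_mk_of_subset fun i hi => hsa t hi)

theorem exists_forall_of_forall_lt {ι β : Type u} [LinearOrder ι] [WellFoundedLT ι]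
    (P : ∀ a : ι, (Set.Iio a → β) → β → Prop) (h : ∀ a F, ∃ b, P a F b) :
    ∃ f : ι → β, ∀ a, P a (fun x => f x) (f a) := by
  choose g hg using h
  let f : ι → β := (wellFounded_lt (α := ι)).fix fun a F => g a fun x => F x.1 x.2
  refine ⟨f, fun a => ?_⟩
  have : f a = g a fun x => f x := WellFounded.fix_eq _ _ _
  rw [this]
  exact hg _ _

/-! ### Coding points by cuts -/

/-- The points whose set of cuts is computed from the cuts of some `x ∈ S` by the code `E`. -/
def cover {L Q : Type u} (C : Q → Set L) {n : ℕ} (S : Set (Fin n → L))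
    (E : Set ((Fin n → Q) × Q)) (w : Set (Fin n)) (ε : Prop) : Set L :=
  {y | ∃ x ∈ S, ∀ q, (y ∈ C q ↔ ε) ↔ ∃ p, (p, q) ∈ E ∧ ∀ l, ¬ (x l ∈ C (p l) ↔ l ∈ w)}

/-- Each `x ∈ S` decides every cut of the `y` it computes, and cuts separate points, so `x`
determines `y`. -/
theorem mk_cover_le {L Q : Type u} [LinearOrder L] {C : Q → Set L}
    (hC : ∀ x y, x < y ↔ ∃ q, x ∈ C q ∧ y ∉ C q) {n : ℕ} (S : Set (Fin n → L))
    (E : Set ((Fin n → Q) × Q)) (w : Set (Fin n)) (ε : Prop) :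
    #(cover C S E w ε) ≤ #S := by
  choose g hgS hg using fun y : cover C S E w ε => y.2
  refine mk_le_of_injective (f := fun y => (⟨g y, hgS y⟩ : S)) fun y z hyz => ?_
  have hyz : g y = g z := congrArg Subtype.val hyz
  have key : ∀ q, (y : L) ∈ C q ↔ (z : L) ∈ C q := fun q => by
    have h1 := hg y q
    rw [hyz, ← hg z q] at h1
    tauto
  refine Subtype.ext (le_antisymm (not_lt.1 fun h => ?_) (not_lt.1 fun h => ?_))
  · obtain ⟨q, h1, h2⟩ := (hC _ _).1 h
    exact h2 ((key q).2 h1)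
  · obtain ⟨q, h1, h2⟩ := (hC _ _).1 h
    exact h2 ((key q).1 h1)

/-- If each `f α` avoids, up to small sets, everything covered by finitely many earlier `f β`, then
any finitely many injective sequences in distinct ranges can be separated by cuts in a prescribed
pattern. -/
theorem exists_cut {L Q : Type u} {C : Q → Set L} {κ : Cardinal.{u}} (hκ : κ.IsRegular)
    (hκ' : ℵ₀ < κ) (hQ : #Q < κ) {ι K : Type u} [LinearOrder ι] [LinearOrder K]
    (hK : ∀ k : K, #(Set.Iic k) < κ) (f : ι → K → L)
    (hf : ∀ (α : ι) (n : ℕ) (a : Fin n → ι), (∀ l, a l < α) → ∀ E w ε,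
      #{i | f α i ∈ cover C {x | ∃ i : Fin n → K, x = fun l => f (a l) (i l)} E w ε} < κ)
    (n : ℕ) : ∀ (a : Fin n → ι), StrictMono a → ∀ (X : Set K), κ ≤ #X → ∀ t : Fin n → K → L,
      (∀ l, Set.InjOn (t l) X) → (∀ l, ∀ k ∈ X, t l k ∈ Set.range (f (a l))) →
      ∀ w : Set (Fin n), ∃ ζ ∈ X, ∃ ξ ∈ X, ζ < ξ ∧
        ∀ l, ∃ q, (t l ζ ∈ C q ↔ l ∈ w) ∧ ¬ (t l ξ ∈ C q ↔ l ∈ w) := by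
  induction n with
  | zero =>
    intro a _ X hX t _ _ w
    have : Nontrivial X := one_lt_iff_nontrivial.1 (one_lt_aleph0.trans (hκ'.trans_le hX))
    obtain ⟨x, y, hxy⟩ := exists_pair_lt X
    exact ⟨x, x.2, y, y.2, hxy, fun l => l.elim0⟩
  | succ n ih =>
    intro a ha X hX t hinj hran w
    by_contra! H
    let w' : Set (Fin n) := {l | l.castSucc ∈ w}
    let ε : Prop := Fin.last n ∈ w
    -- The failure recorded as a code: by `H`, no `ξ` later than a witness `ζ` is opposite to `ζ` at
    -- all the cuts of the tuple.
    let E : Set ((Fin n → Q) × Q) := {p | ∃ ζ ∈ X, (∀ l, t l.castSucc ζ ∈ C (p.1 l) ↔ l ∈ w') ∧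
      (t (Fin.last n) ζ ∈ C p.2 ↔ ε)}
    have hE : ∀ p : E, ∃ ζ ∈ X, (∀ l, t l.castSucc ζ ∈ C (p.1.1 l) ↔ l ∈ w') ∧
      (t (Fin.last n) ζ ∈ C p.1.2 ↔ ε) := fun p => p.2
    choose Z hZX hZ hZ' using hE
    have hEκ : #E < κ := by
      refine (mk_subtype_le _).trans_lt ?_
      have h1 : #(Fin n → Q) < κ := by
        have : #(Fin n → Q) = #Q ^ n := by simp
        rw [this]
        exact (power_nat_le_max).trans_lt (max_lt hQ hκ')
      simpa using mul_lt_of_lt hκ'.le h1 hQ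
    let B₁ : Set K := ⋃ p : E, Set.Iic (Z p)
    have hB₁ : #B₁ < κ :=
      (card_iUnion_lt_iff_forall_of_isRegular hκ hEκ).2 fun p => hK _
    let D : Q → Set K := fun q => {ξ ∈ X | (t (Fin.last n) ξ ∈ C q ↔ ε) ∧
      ∀ p, (p, q) ∈ E → ∃ l, t l.castSucc ξ ∈ C (p l) ↔ l ∈ w'}
    have hD : ∀ q, #(D q) < κ := by
      intro q
      by_contra! hq
      -- Inside `D q`, induction gives cuts `p` separating `ζ` from `ξ`; then `ζ` puts `(p, q)` in
      -- `E`, which `ξ ∈ D q` forbids.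
      obtain ⟨ζ, hζ, ξ, hξ, -, h⟩ := ih (fun l => a l.castSucc)
        (ha.comp (Fin.strictMono_castSucc)) (D q) hq (fun l => t l.castSucc)
        (fun l => (hinj _).mono fun x hx => hx.1) (fun l k hk => hran _ k hk.1) w'
      choose p hp hp' using h
      obtain ⟨l, hl⟩ := hξ.2.2 p ⟨ζ, hζ.1, hp, hζ.2.1⟩
      exact hp' l hl
    let B₂ : Set K := ⋃ q, D q
    have hB₂ : #B₂ < κ := (card_iUnion_lt_iff_forall_of_isRegular hκ hQ).2 hD
    let P : Set L :=
      cover C {x | ∃ i : Fin n → K, x = fun l => f (a l.castSucc) (i l)} E w' ε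
    have hP : #{i | f (a (Fin.last n)) i ∈ P} < κ :=
      hf _ n (fun l => a l.castSucc) (fun l => ha (Fin.castSucc_lt_last l)) E w' ε
    have hgood : ∀ ξ ∈ X, ξ ∉ B₁ → ξ ∉ B₂ → t (Fin.last n) ξ ∈ P := by
      intro ξ hξ h1 h2
      choose i hi using fun l : Fin n => hran l.castSucc ξ hξ
      refine ⟨fun l => t l.castSucc ξ, ⟨i, funext fun l => (hi l).symm⟩, fun q => ⟨fun hq => ?_, ?_⟩⟩
      · by_contra! h
        exact h2 (Set.mem_iUnion.2 ⟨q, hξ, hq, h⟩)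
      · rintro ⟨p, hp, hl⟩
        have hlt : Z ⟨(p, q), hp⟩ < ξ := by
          simp only [B₁, Set.mem_iUnion, Set.mem_Iic, not_exists, not_le] at h1
          exact h1 _
        obtain ⟨l, h⟩ := H _ (hZX ⟨(p, q), hp⟩) ξ hξ hlt
        induction l using Fin.lastCases with
        | last => exact h q (hZ' ⟨(p, q), hp⟩)
        | cast l => exact absurd (h (p l) (hZ ⟨(p, q), hp⟩ l)) (hl l)
    let G : Set K := {ξ ∈ X | t (Fin.last n) ξ ∈ P}
    have hG : #G < κ := by
      refine lt_of_le_of_lt ?_ hP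
      choose i hi using fun ξ : G => hran (Fin.last n) ξ ξ.2.1
      refine mk_le_of_injective
        (f := fun ξ => (⟨i ξ, by rw [Set.mem_ofPred_eq, hi]; exact ξ.2.2⟩ :
          {i | f (a (Fin.last n)) i ∈ P})) fun ξ ξ' h => ?_
      refine Subtype.ext (hinj (Fin.last n) ξ.2.1 ξ'.2.1 ?_)
      rw [← hi, ← hi]
      exact congrArg (f (a (Fin.last n))) (congrArg Subtype.val h)
    have hsub : X ⊆ B₁ ∪ B₂ ∪ G := by
      intro ξ hξ
      by_cases h1 : ξ ∈ B₁
      · exact Or.inl (Or.inl h1)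
      by_cases h2 : ξ ∈ B₂
      · exact Or.inl (Or.inr h2)
      · exact Or.inr ⟨hξ, hgood ξ hξ h1 h2⟩
    refine absurd hX (not_le.2 ?_)
    refine (mk_le_mk_of_subset hsub).trans_lt ((mk_union_le _ _).trans_lt ?_)
    refine add_lt_of_lt hκ'.le ((mk_union_le _ _).trans_lt ?_) hG
    exact add_lt_of_lt hκ'.le hB₁ hB₂

/-! ### A linear order with few cuts -/

theorem exists_linearOrder_cuts {μ : Cardinal.{u}} (hμ : μ.IsStrongLimit) :
    ∃ (L Q : Type u) (_ : LinearOrder L) (C : Q → Set L), #L = 2 ^ μ ∧ #Q ≤ μ ∧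
      ∀ x y, x < y ↔ ∃ q, x ∈ C q ∧ y ∉ C q := by
  classical
  let M := μ.ord.ToType
  -- A bounded sequence followed by one `true`, then `false`s. If `x < y` first differ at `i`, the
  -- code of `x` below `i` lies in `(x, y]`.
  let e : (Σ i : M, (Set.Iio i → Bool)) → Lex (M → Bool) := fun q =>
    toLex fun k => if h : k < q.1 then q.2 ⟨k, h⟩ else decide (k = q.1)
  refine ⟨Lex (M → Bool), Σ i : M, (Set.Iio i → Bool), inferInstance,
    fun q => Set.Iio (e q), ?_, ?_, fun x y => ⟨?_, ?_⟩⟩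
  · change #(M → Bool) = _
    simp [M]
  · rw [mk_sigma]
    refine (sum_le_sum _ (fun _ => μ) fun i => ?_).trans ?_
    · have h := hμ.isStrongPrelimit (mk_Iio_ord_toType_lt i)
      simpa using h.le
    · simp [M, mul_eq_self hμ.aleph0_le]
  · rintro ⟨i, hi, hlt⟩
    have hx : x i = false := (Bool.lt_iff.1 hlt).1
    have hy : y i = true := (Bool.lt_iff.1 hlt).2
    refine ⟨⟨i, fun k => x k⟩, ⟨i, fun k hk => ?_, ?_⟩, ?_⟩
    · simp [e, hk]
    · simp [e, hx]
    · rintro ⟨k, hk, hlt'⟩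
      have hyk : y k = false := (Bool.lt_iff.1 hlt').1
      have hek : e ⟨i, fun k => x k⟩ k = true := (Bool.lt_iff.1 hlt').2
      rcases lt_trichotomy k i with h | rfl | h
      · have : x k = true := by simpa [e, h] using hek
        have hxy : x k = y k := hi k h
        simp [hyk, this] at hxy
      · simp [hyk] at hy
      · simp [e, h.not_gt, h.ne'] at hek
  · rintro ⟨q, h1, h2⟩
    exact lt_of_lt_of_le h1 (not_lt.1 h2)

/-- Ensures that the infimum defining `U` is attained and is not the default `sInf ∅ = 0`. -/
theorem nonempty_U_set {κ χ : Cardinal.{u}} (hκ : ℵ₀ ≤ κ) (hκχ : κ ≤ χ) :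
    {c | ∃ A : Set (Set χ.ord.ToType), #A = c ∧ (∀ a ∈ A, #a = κ) ∧
      ∀ f : κ.ord.ToType → χ.ord.ToType,
        ∃ a ∈ A, {i | f i ∈ a} ∉ bddIdeal κ.ord.ToType}.Nonempty := by
  refine ⟨_, {a | #a = κ}, rfl, fun a ha => ha, fun f => ?_⟩
  obtain ⟨a, hfa, ha⟩ := exists_superset_mk_eq (s := Set.range f) hκ (by simpa using hκχ)
    (mk_range_le.trans (by simp))
  refine ⟨a, ha, fun h => absurd (mk_lt_of_mem_bddIdeal hκ h) (not_lt.2 ?_)⟩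
  have : {i | f i ∈ a} = Set.univ := Set.eq_univ_of_forall fun i => hfa ⟨i, rfl⟩
  simp [this]

/-! ### The recursive construction -/

theorem ens_U {μ κ χ : Cardinal.{u}} (hμ : μ.IsStrongLimit) (hμκ : μ < κ) (hκ : κ.IsRegular)
    (hκχ : κ < χ) (hχ : χ ≤ 2 ^ μ) (hU : 2 ^ μ < U (bddIdeal κ.ord.ToType) χ) :
    Ens κ (U (bddIdeal κ.ord.ToType) χ) := by
  obtain ⟨L, Q, _, C, hL, hQ, hC⟩ := exists_linearOrder_cuts hμ
  have hκ' : ℵ₀ < κ := hμ.aleph0_le.trans_lt hμκ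
  set lam := U (bddIdeal κ.ord.ToType) χ with hlam
  have hlam0 : ℵ₀ ≤ lam := hμ.aleph0_le.trans ((cantor μ).le.trans hU.le)
  obtain ⟨j⟩ : Nonempty (χ.ord.ToType ↪ L) := by
    rw [← le_def, hL]
    simpa using hχ
  let T : lam.ord.ToType → Type u := fun α => Σ n : ℕ,
    (Fin n → Set.Iio α) × Set ((Fin n → Q) × Q) × Set (Fin n) × Prop
  have hT : ∀ α, #(T α) < lam := by
    intro α
    obtain ⟨c, hc, hαc, hμc⟩ : ∃ c < lam, #(Set.Iio α) ≤ c ∧ 2 ^ μ ≤ c :=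
      ⟨_, max_lt (mk_Iio_ord_toType_lt α) hU, le_max_left _ _, le_max_right _ _⟩
    have hc0 : ℵ₀ ≤ c := (hμ.aleph0_le.trans (cantor μ).le).trans hμc
    refine lt_of_le_of_lt ?_ hc
    rw [mk_sigma]
    refine (sum_le_sum _ (fun _ => c) fun n => ?_).trans ?_
    · have hpow : ∀ {X : Type u} {d : Cardinal.{u}}, ℵ₀ ≤ d → #X ≤ d → #(Fin n → X) ≤ d := by
        intro X d hd hX
        have : #(Fin n → X) = #X ^ n := by simp
        rw [this]
        exact power_nat_le_max.trans (max_le hX hd)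
      have h1 : #(Fin n → Set.Iio α) ≤ c := hpow hc0 hαc
      have h2 : #(Set ((Fin n → Q) × Q)) ≤ c := by
        rw [mk_set]
        refine (power_le_power_left two_ne_zero ?_).trans hμc
        have := mul_le_of_le hμ.aleph0_le (hpow hμ.aleph0_le hQ) hQ
        simpa using this
      have h3 : lift.{u} #(Set (Fin n) × Prop) ≤ c :=
        (lift_lt_aleph0.2 (lt_aleph0_of_finite _)).le.trans hc0
      have := mul_le_of_le hc0 h1 (mul_le_of_le hc0 h2 h3)
      simpa only [mk_prod, lift_id, lift_uzero, lift_mul] using this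
    · simp [hc0]
  obtain ⟨f, hf⟩ := exists_forall_of_forall_lt (β := κ.ord.ToType → L)
    (fun (α : lam.ord.ToType) F g => ∀ τ : T α, #{i | g i ∈ cover C
      {x | ∃ i : Fin τ.1 → κ.ord.ToType, x = fun l => F (τ.2.1 l) (i l)}
      τ.2.2.1 τ.2.2.2.1 τ.2.2.2.2} < κ)
    (fun α F => exists_avoiding hκ'.le hκχ.le j _
      (fun τ => by
        refine (mk_cover_le hC _ _ _ _).trans ?_
        have h : {x | ∃ i : Fin τ.1 → κ.ord.ToType, x = fun l => F (τ.2.1 l) (i l)} =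
            Set.range fun (i : Fin τ.1 → κ.ord.ToType) l => F (τ.2.1 l) (i l) := by
          ext x
          simp [eq_comm]
        rw [h]
        refine mk_range_le.trans ?_
        have : #(Fin τ.1 → κ.ord.ToType) = κ ^ τ.1 := by simp
        rw [this]
        exact power_nat_le_max.trans (max_le le_rfl hκ'.le))
      (hT α))
  have hcut := exists_cut hκ hκ' (hQ.trans_lt hμκ) (mk_Iic_ord_toType_lt hκ'.le) f
    (fun α n a ha E w ε => hf α ⟨n, fun l => ⟨a l, ha l⟩, E, w, ε⟩)
  have hcard : ∀ α, #(Set.range (f α)) = κ := by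
    intro α
    refine le_antisymm (mk_range_le.trans (by simp)) (not_lt.1 fun hlt => ?_)
    have hfib : ∀ y : Set.range (f α), #(f α ⁻¹' {(y : L)}) < κ := by
      intro y
      refine lt_of_le_of_lt (mk_le_mk_of_subset ?_)
        -- With `n = 0`, the set of cuts of `y` is itself a code computing `y`, so fibres of `f α`
        -- are small.
        (hf α ⟨0, Fin.elim0, {p | (y : L) ∈ C p.2}, ∅, True⟩)
      intro i hi
      have hi : f α i = y := hi
      refine ⟨Fin.elim0, ⟨Fin.elim0, funext fun l => l.elim0⟩, fun q => ?_⟩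
      rw [hi]
      simp
    have h := (card_iUnion_lt_iff_forall_of_isRegular hκ hlt).2 hfib
    have hun : ⋃ y : Set.range (f α), f α ⁻¹' {(y : L)} = Set.univ :=
      Set.eq_univ_of_forall fun i => Set.mem_iUnion.2 ⟨⟨_, i, rfl⟩, rfl⟩
    rw [hun] at h
    simp at h
  have hne : Nonempty lam.ord.ToType := by
    rw [← mk_ne_zero_iff]
    simpa using (aleph0_pos.trans_le hlam0).ne'
  refine ⟨fun α => Set.range (f α), fun α => inferInstance, hcard, ?_⟩
  have hinf : ⨅ α, #(Set.range (f α)) = κ := by simp [hcard]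
  unfold IsEntangled
  rw [hinf]
  refine ⟨fun α => (hcard α).ge, fun n a ha t ht w => ?_⟩
  obtain ⟨ζ, -, ξ, -, hlt, h⟩ := hcut n a ha Set.univ (by simp) (fun l k => (t l k : L))
    (fun l => (Subtype.val_injective.comp (ht l)).injOn) (fun l k _ => (t l k).2) w
  refine ⟨ζ, ξ, hlt, fun l hl => ?_, fun l hl => ?_⟩
  · obtain ⟨q, h1, h2⟩ := h l
    exact (hC _ _).2 ⟨q, by simpa [hl] using h1, by simpa [hl] using h2⟩
  · obtain ⟨q, h1, h2⟩ := h l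
    exact (hC _ _).2 ⟨q, by simpa [hl] using h2, by simpa [hl] using h1⟩

/-! ### The cofinality criterion -/

theorem lt_U_of_cof_eq {κ χ : Cardinal.{u}} (hκ : ℵ₀ ≤ κ) (hκχ : κ < χ)
    (hcof : χ.ord.cof = κ) : χ < U (bddIdeal κ.ord.ToType) χ := by
  by_contra! hU
  have hχ : ℵ₀ ≤ χ := hκ.trans hκχ.le
  obtain ⟨A, hA, hAκ, hAf⟩ := csInf_mem (nonempty_U_set hκ hκχ.le)
  have hAχ : #A ≤ χ := hA.le.trans hU
  obtain ⟨e⟩ : Nonempty (A ↪ χ.ord.ToType) := by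
    rw [← le_def]
    simpa using hAχ
  obtain ⟨S, hS, hSκ⟩ := Order.exists_cof_eq χ.ord.ToType
  have hSκ : #S = κ := by rw [hSκ, ← hcof]; simp
  obtain ⟨c⟩ : Nonempty (κ.ord.ToType ≃ S) := by
    rw [← Cardinal.eq, hSκ]
    simp
  -- The enumeration `c` need not be monotone, so it is bounded on initial segments, which are too
  -- short to be cofinal.
  have hbdd : ∀ i : κ.ord.ToType, ∃ β, ∀ i' ≤ i, (c i' : χ.ord.ToType) < β := by
    intro i
    have : ¬ IsCofinal ((fun i' => (c i' : χ.ord.ToType)) '' Set.Iic i) := by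
      intro h
      have h1 := (Order.cof_le h).trans mk_image_le
      have h2 : Order.cof χ.ord.ToType = κ := by rw [← hcof]; simp
      exact absurd (mk_Iic_ord_toType_lt hκ i) (not_lt.2 (h2 ▸ h1))
    obtain ⟨β, hβ⟩ := not_isCofinal_iff.1 this
    exact ⟨β, fun i' hi' => hβ _ ⟨i', hi', rfl⟩⟩
  choose β hβ using hbdd
  -- Fewer than `χ` sets of size `κ < χ` cannot cover `χ`.
  have hx : ∀ i, ∃ x : χ.ord.ToType, ∀ a : A, e a ≤ β i → x ∉ (a : Set χ.ord.ToType) := by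
    intro i
    by_contra! h
    have hcov : Set.univ ⊆ ⋃ a : {a : A // e a ≤ β i}, ((a : A) : Set χ.ord.ToType) := by
      intro x _
      obtain ⟨a, ha, hxa⟩ := h x
      exact Set.mem_iUnion.2 ⟨⟨a, ha⟩, hxa⟩
    have h1 : #{a : A // e a ≤ β i} < χ :=
      (mk_le_of_injective (f := fun a => (⟨e a.1, a.2⟩ : Set.Iic (β i))) fun a b hab =>
        Subtype.ext (e.injective (congrArg Subtype.val hab))).trans_lt
        (mk_Iic_ord_toType_lt hχ (β i))
    have h2 := (mk_le_mk_of_subset hcov).trans (mk_iUnion_le_sum_mk)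
    have h3 : (Cardinal.sum fun a : {a : A // e a ≤ β i} =>
        #((a : A) : Set χ.ord.ToType)) < χ := by
      simp only [hAκ _ (Subtype.coe_prop _), sum_const']
      exact mul_lt_of_lt hχ h1 hκχ
    simp only [mk_univ, mk_ord_toType] at h2
    exact absurd h2 (not_le.2 h3)
  choose f hf using hx
  obtain ⟨a, haA, ha⟩ := hAf f
  refine ha (Or.inr ?_)
  obtain ⟨s, hsS, hs⟩ := hS (e ⟨a, haA⟩)
  refine ⟨c.symm ⟨s, hsS⟩, fun i hi => not_lt.1 fun hlt => hf i ⟨a, haA⟩ ?_ hi⟩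
  have := hβ i (c.symm ⟨s, hsS⟩) hlt.le
  simp only [Equiv.apply_symm_apply] at this
  exact hs.trans this.le

end Entangled

theorem mainTheorem5 :
    (∀ κ χ : Cardinal.{u}, ℵ₀ < κ → κ.IsRegular → κ < χ → χ ≤ 2 ^ ℵ₀ →
      (2 ^ ℵ₀ < Entangled.U (Entangled.bddIdeal κ.ord.ToType) χ →
        Entangled.Ens κ (Entangled.U (Entangled.bddIdeal κ.ord.ToType) χ)) ∧
      (χ = 2 ^ ℵ₀ → χ.ord.cof = κ →
        2 ^ ℵ₀ < Entangled.U (Entangled.bddIdeal κ.ord.ToType) χ)) ∧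
    (∀ μ κ χ : Cardinal.{u}, μ.IsStrongLimit → μ.IsSingular →
      μ < κ → κ.IsRegular → κ < χ → χ ≤ 2 ^ μ →
      (2 ^ μ < Entangled.U (Entangled.bddIdeal κ.ord.ToType) χ →
        Entangled.Ens κ (Entangled.U (Entangled.bddIdeal κ.ord.ToType) χ)) ∧
      (χ = 2 ^ μ → χ.ord.cof = κ →
        2 ^ μ < Entangled.U (Entangled.bddIdeal κ.ord.ToType) χ)) := by
  refine ⟨fun κ χ hκ hreg hκχ hχ => ⟨?_, ?_⟩, fun μ κ χ hμ _ hμκ hreg hκχ hχ => ⟨?_, ?_⟩⟩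
  · exact Entangled.ens_U isStrongLimit_aleph0 hκ hreg hκχ hχ
  · rintro rfl hcof
    exact Entangled.lt_U_of_cof_eq hκ.le hκχ hcof
  · exact Entangled.ens_U hμ hμκ hreg hκχ hχ
  · rintro rfl hcof
    exact Entangled.lt_U_of_cof_eq hreg.aleph0_le hκχ hcof
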